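/- For an integer $n \ge 3$ let $$K_n = \{\theta \in \mathbb{R}^n : \theta_i - \theta_{i-1} \ge \theta_{i+1} - \theta_i \text{ whenever } 2 \le i \le n-1\}$$ be the set of concave sequences of length $n$, and for $B > 0$ let $K_{n,B} = \{\theta \in K_n : \max_{1 \le i \le n} |\theta_i| \le B\}$. For $\epsilon > 0$ let $N(\epsilon, K_{n,B})$ be the minimum number of closed Euclidean balls of radius $\epsilon$, with centers in $K_{n,B}$, required to cover $K_{n,B}$. Then there is a universal constant $C > 0$ (not depending on $n$, $B$ or $\epsilon$) such that for all $n \ge 3$, all $B > 0$ and all $\epsilon > 0$ the number $N(\epsilon, K_{n,B})$ is finite and $$\log N(\epsilon, K_{n,B}) \le C\, n^{1/4} \sqrt{\frac{B}{\epsilon}}.$$ -/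

import Mathlib

open scoped NNReal

/-- The cone `K_n` of concave sequences in `ℝⁿ` (with its Euclidean metric): all `θ` such that
`θ_i - θ_{i-1} ≥ θ_{i+1} - θ_i` for `2 ≤ i ≤ n - 1`. The coordinates are indexed from `0` here, so
the middle index is `i + 1` with `i + 2 < n`. -/
def concaveSeq (n : ℕ) : Set (EuclideanSpace ℝ (Fin n)) :=
  {θ | ∀ (i : ℕ) (h : i + 2 < n),
    θ ⟨i + 1, by omega⟩ - θ ⟨i, by omega⟩ ≥ θ ⟨i + 2, h⟩ - θ ⟨i + 1, by omega⟩}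

/-- `K_{n,B} = {θ ∈ K_n : max_i |θ_i| ≤ B}`. -/
def boundedConcaveSeq (n : ℕ) (B : ℝ) : Set (EuclideanSpace ℝ (Fin n)) :=
  {θ | θ ∈ concaveSeq n ∧ ∀ i : Fin n, |θ i| ≤ B}

/-! A covering bound follows from a labelling in which equally labelled sequences are `ε`-close: one
representative per label is a net inside the set (`Coded.coveringNumber_le`). Costs, meaning
logarithms of numbers of labels, add up.

A concave sequence of length `N` with `|f| ≤ B`, slopes at most `L` and `N * L ≤ 2 * B` can be coded
to sup-accuracy of order `B / M ^ 2` at cost of order `M` (`coded_concavePiece_nat`). Record to that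
accuracy about `M` samples of `f` and `M + 1` values of its Legendre transform. Both lists are
concave up to sign, so their rounded second differences are cheap to count
(`coded_concaveSlopeBounded`). Together they pin down `f` between samples
(`le_add_of_legendre_close`).

Slopes may be large near the ends, but are at most `2 * B / (i + 1)` in the left half
(`mem_concaveHalf`), so each dyadic block satisfies `N * L ≤ 2 * B`. Budgets decaying geometrically
towards the end keep both the total cost and the squared error bounded by geometric series
(`coded_concaveHalf`). The right half is handled by reflection. -/

/-- The elements of `S` can be labelled by a nonempty finite type, the logarithm of whose cardinality
is at most `b`, in such a way that elements with the same label are related by `R`. -/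
def Coded {α : Type} (S : Set α) (R : α → α → Prop) (b : ℝ) : Prop :=
  ∃ (ι : Type) (_ : Fintype ι) (_ : Nonempty ι) (c : α → ι),
    Real.log (Fintype.card ι) ≤ b ∧ ∀ f ∈ S, ∀ g ∈ S, c f = c g → R f g

namespace Coded

variable {α β : Type} {S : Set α} {R R' : α → α → Prop} {b b' : ℝ}

theorem mono (h : Coded S R b) (hR : ∀ f ∈ S, ∀ g ∈ S, R f g → R' f g) (hb : b ≤ b') :
    Coded S R' b' := by
  obtain ⟨ι, i1, i2, c, h1, h2⟩ := h
  exact ⟨ι, i1, i2, c, h1.trans hb, fun f hf g hg e => hR f hf g hg (h2 f hf g hg e)⟩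

theorem of_forall (hR : ∀ f ∈ S, ∀ g ∈ S, R f g) (hb : 0 ≤ b) : Coded S R b :=
  ⟨Unit, inferInstance, inferInstance, fun _ => (), by simpa using hb,
    fun f hf g hg _ => hR f hf g hg⟩

theorem comap {T : Set β} (φ : β → α) (h : Coded S R b) (hφ : Set.MapsTo φ T S) :
    Coded T (fun f g => R (φ f) (φ g)) b := by
  obtain ⟨ι, i1, i2, c, h1, h2⟩ := h
  exact ⟨ι, i1, i2, c ∘ φ, h1, fun f hf g hg e => h2 _ (hφ hf) _ (hφ hg) e⟩

theorem of_mapsTo (c : α → β) (F : Finset β) (hc : ∀ f ∈ S, c f ∈ F) (hb : Real.log F.card ≤ b)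
    (hb0 : 0 ≤ b) (hR : ∀ f ∈ S, ∀ g ∈ S, c f = c g → R f g) : Coded S R b := by
  classical
  rcases S.eq_empty_or_nonempty with rfl | ⟨f₀, hf₀⟩
  · exact of_forall (by simp) hb0
  -- Labels outside `S` are irrelevant; `c f₀` only makes the labelling total.
  refine ⟨F, inferInstance, ⟨⟨c f₀, hc f₀ hf₀⟩⟩,
    fun f => if h : c f ∈ F then ⟨c f, h⟩ else ⟨c f₀, hc f₀ hf₀⟩, by simpa using hb, ?_⟩
  intro f hf g hg e
  simp only [hc f hf, hc g hg, dite_true, Subtype.mk.injEq] at e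
  exact hR f hf g hg e

theorem and (h : Coded S R b) (h' : Coded S R' b') :
    Coded S (fun f g => R f g ∧ R' f g) (b + b') := by
  obtain ⟨ι, i1, i2, c, h1, h2⟩ := h
  obtain ⟨ι', i1', i2', c', h1', h2'⟩ := h'
  refine ⟨ι × ι', inferInstance, inferInstance, fun f => (c f, c' f), ?_, ?_⟩
  · rw [Fintype.card_prod, Nat.cast_mul, Real.log_mul (by simp) (by simp)]
    exact add_le_add h1 h1'
  · intro f hf g hg e
    rw [Prod.mk.injEq] at e
    exact ⟨h2 f hf g hg e.1, h2' f hf g hg e.2⟩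

theorem pi {K : ℕ} {R : ℕ → α → α → Prop} {b : ℕ → ℝ} (h : ∀ k < K, Coded S (R k) (b k)) :
    Coded S (fun f g => ∀ k < K, R k f g) (∑ k ∈ Finset.range K, b k) := by
  induction K with
  | zero => exact of_forall (by simp) (by simp)
  | succ K ih =>
    rw [Finset.sum_range_succ]
    refine ((ih fun k hk => h k (by omega)).and (h K (by omega))).mono ?_ le_rfl
    rintro f - g - ⟨h1, h2⟩ k hk
    rcases Nat.lt_succ_iff_lt_or_eq.1 hk with hk | rfl
    · exact h1 k hk
    · exact h2

end Coded

/-! ### Counting tuples with bounded sum -/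

theorem log_le_two_mul_sqrt {x : ℝ} (hx : 0 < x) : Real.log x ≤ 2 * √x := by
  have h := Real.log_le_sub_one_of_pos (Real.sqrt_pos.2 hx)
  rw [Real.log_sqrt hx.le] at h
  linarith

/-- The tuples of `G` naturals with sum at most `S`. -/
def boundedTuples (G S : ℕ) : Finset (Fin G → ℕ) :=
  {d ∈ Fintype.piFinset fun _ => Finset.range (S + 1) | ∑ i, d i ≤ S}

theorem mem_boundedTuples {G S : ℕ} {d : Fin G → ℕ} :
    d ∈ boundedTuples G S ↔ ∑ i, d i ≤ S := by
  simp only [boundedTuples, Finset.mem_filter, Fintype.mem_piFinset, Finset.mem_range,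
    and_iff_right_iff_imp]
  intro h i
  have := Finset.single_le_sum (f := d) (fun _ _ => Nat.zero_le _) (Finset.mem_univ i)
  omega

/-- Generating function bound: each counted tuple has weight at least `q ^ S`, and the total weight
factors into geometric series. -/
theorem card_boundedTuples_mul_pow_le (G S : ℕ) {q : ℝ} (h0 : 0 < q) (h1 : q < 1) :
    (boundedTuples G S).card * q ^ S ≤ ((1 - q)⁻¹) ^ G := by
  calc ((boundedTuples G S).card : ℝ) * q ^ S
      = ∑ d ∈ boundedTuples G S, q ^ S := by rw [Finset.sum_const, nsmul_eq_mul]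
    _ ≤ ∑ d ∈ boundedTuples G S, ∏ i, q ^ d i := by
        refine Finset.sum_le_sum fun d hd => ?_
        rw [Finset.prod_pow_eq_pow_sum]
        exact pow_le_pow_of_le_one h0.le h1.le (mem_boundedTuples.1 hd)
    _ ≤ ∑ d ∈ Fintype.piFinset fun _ : Fin G => Finset.range (S + 1), ∏ i, q ^ d i :=
        Finset.sum_le_sum_of_subset_of_nonneg (Finset.filter_subset _ _)
          fun _ _ _ => Finset.prod_nonneg fun _ _ => by positivity
    _ = (∑ j ∈ Finset.range (S + 1), q ^ j) ^ G := by
        rw [Finset.sum_prod_piFinset]; simp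
    _ ≤ _ := by
        refine pow_le_pow_left₀ (by positivity) ?_ G
        rw [← tsum_geometric_of_lt_one h0.le h1]
        exact (summable_geometric_of_lt_one h0.le h1).sum_le_tsum _ fun _ _ => by positivity

theorem log_card_boundedTuples_le {G S : ℕ} (hG : 1 ≤ G) (hS : 1 ≤ S) :
    Real.log (boundedTuples G S).card ≤ 3 * G + 2 * √(G * S) := by
  have hG' : (0 : ℝ) < G := by exact_mod_cast hG
  have hS' : (0 : ℝ) < S := by exact_mod_cast hS
  have hpos : (0 : ℝ) < (boundedTuples G S).card := by
    exact_mod_cast Finset.card_pos.2 ⟨fun _ => 0, mem_boundedTuples.2 (by simp)⟩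
  -- This `q` minimises `q ^ (-S) * (1 - q) ^ (-G)`.
  set q : ℝ := S / (S + G) with hq
  have hq0 : 0 < q := by positivity
  have hq1 : q < 1 := by rw [hq, div_lt_one (by positivity)]; linarith
  have h := Real.log_le_log (by positivity) (card_boundedTuples_mul_pow_le G S hq0 hq1)
  rw [Real.log_mul hpos.ne' (by positivity), Real.log_pow, Real.log_pow] at h
  have e1 : (1 - q)⁻¹ = (S + G) / G := by
    rw [hq, one_sub_div (by positivity), add_sub_cancel_left, inv_div]
  have e2 : -Real.log q ≤ G / S := by
    rw [← Real.log_inv]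
    refine (Real.log_le_sub_one_of_pos (by positivity)).trans (le_of_eq ?_)
    rw [hq]; field_simp; ring
  have e3 : S * -Real.log q ≤ G := by
    calc S * -Real.log q ≤ S * (G / S : ℝ) := by gcongr
      _ = G := by field_simp
  have e4 : G * Real.log ((S + G) / G) ≤ 2 * √(G * S) + 2 * G := by
    calc G * Real.log ((S + G) / G) ≤ G * (2 * √((S + G) / G)) := by
          gcongr; exact log_le_two_mul_sqrt (by positivity)
      _ = 2 * √(G * S + G * G) := by
          have : (G * S + G * G : ℝ) = G ^ 2 * ((S + G) / G) := by field_simp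
          rw [this, Real.sqrt_mul (by positivity), Real.sqrt_sq hG'.le]; ring
      _ ≤ 2 * (√(G * S) + √(G * G)) := by
          gcongr; exact Real.sqrt_le_iff.2 ⟨by positivity, by
            nlinarith [Real.sq_sqrt (show (0 : ℝ) ≤ G * S by positivity),
              Real.sq_sqrt (show (0 : ℝ) ≤ G * G by positivity),
              mul_nonneg (Real.sqrt_nonneg (G * S : ℝ)) (Real.sqrt_nonneg (G * G : ℝ))]⟩
      _ = _ := by rw [Real.sqrt_mul_self hG'.le]; ring
  rw [e1] at h
  linarith

theorem log_card_Icc_floor_le {P : ℝ} (hP : 0 ≤ P) :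
    Real.log (Finset.Icc ⌊-P⌋ ⌊P⌋).card ≤ Real.log (2 * P + 2) := by
  have h1 := Int.floor_le P
  have h2 := Int.lt_floor_add_one (-P)
  have h3 : ⌊-P⌋ ≤ ⌊P⌋ := Int.floor_mono (by linarith)
  refine Real.log_le_log ?_ ?_
  · exact_mod_cast Finset.card_pos.2 (Finset.nonempty_Icc.2 h3)
  · have : (((Finset.Icc ⌊-P⌋ ⌊P⌋).card : ℤ) : ℝ) = ⌊P⌋ + 1 - ⌊-P⌋ := by
      rw [Int.card_Icc, Int.toNat_of_nonneg (by omega)]; push_cast; ring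
    rw [Int.cast_natCast] at this
    rw [this]; linarith

/-! ### Rounding concave sequences to integers -/

/-- Concave sequences of length `G` with bounded initial value and bounded slopes. -/
def concaveSlopeBounded (G : ℕ) (P Q : ℝ) : Set (ℕ → ℝ) :=
  {F | (∀ i, i + 2 < G → F i + F (i + 2) ≤ 2 * F (i + 1)) ∧ |F 0| ≤ P ∧
    ∀ i, i + 1 < G → |F (i + 1) - F i| ≤ Q}

theorem abs_floor_sub_floor_le {x y Q : ℝ} (h : |x - y| ≤ Q) :
    |((⌊x⌋ - ⌊y⌋ : ℤ) : ℝ)| ≤ Q + 1 := by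
  have h1 := Int.floor_le x
  have h2 := Int.lt_floor_add_one x
  have h3 := Int.floor_le y
  have h4 := Int.lt_floor_add_one y
  rw [abs_le] at *
  push_cast
  constructor <;> linarith [h.1, h.2]

/-- One minus the second difference of the integer parts of a sequence. -/
noncomputable def floorConcavity (F : ℕ → ℝ) (i : ℕ) : ℤ :=
  1 - (⌊F (i + 2)⌋ - 2 * ⌊F (i + 1)⌋ + ⌊F i⌋)

/-- Rounding down raises a second difference by less than `2`, so an integer below `2` results; this
is why the definition adds `1`. -/
theorem floorConcavity_nonneg {F : ℕ → ℝ} {i : ℕ} (h : F i + F (i + 2) ≤ 2 * F (i + 1)) :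
    0 ≤ floorConcavity F i := by
  have h1 := Int.floor_le (F i)
  have h2 := Int.floor_le (F (i + 2))
  have h3 := Int.lt_floor_add_one (F (i + 1))
  have : ((⌊F (i + 2)⌋ - 2 * ⌊F (i + 1)⌋ + ⌊F i⌋ : ℤ) : ℝ) < (2 : ℤ) := by push_cast; linarith
  have := Int.cast_lt.1 this
  unfold floorConcavity
  omega

theorem sum_floorConcavity (F : ℕ → ℝ) (m : ℕ) :
    ∑ i ∈ Finset.range m, floorConcavity F i =
      m - (⌊F (m + 1)⌋ - ⌊F m⌋) + (⌊F 1⌋ - ⌊F 0⌋) := by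
  induction m with
  | zero => simp
  | succ m ih => rw [Finset.sum_range_succ, ih, floorConcavity]; push_cast; ring

/-- `floorConcavity` on the indices where it only involves the first `G` terms. -/
noncomputable def floorConcavityTuple (G : ℕ) (F : ℕ → ℝ) (i : Fin G) : ℕ :=
  if (i : ℕ) + 2 < G then (floorConcavity F i).toNat else 0

/-- The sum telescopes to the number of terms plus the difference of two rounded slopes, each at
most `Q + 1` in size. -/
theorem floorConcavityTuple_mem {G : ℕ} {P Q : ℝ} {F : ℕ → ℝ}
    (hF : F ∈ concaveSlopeBounded G P Q) :
    floorConcavityTuple G F ∈ boundedTuples G (⌊2 * Q⌋₊ + G + 1) := by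
  rw [mem_boundedTuples]
  unfold floorConcavityTuple
  rw [Fin.sum_univ_eq_sum_range (fun i => if i + 2 < G then (floorConcavity F i).toNat else 0)]
  rcases lt_or_ge G 2 with hG | hG
  · rw [Finset.sum_eq_zero]
    · omega
    · intro i hi
      rw [if_neg (by omega)]
  obtain ⟨m, rfl⟩ := Nat.exists_eq_add_of_le' hG
  rw [Finset.sum_range_succ, Finset.sum_range_succ, if_neg (by omega), if_neg (by omega),
    add_zero, add_zero]
  obtain ⟨h1, -, h3⟩ := hF
  have e : ((∑ i ∈ Finset.range m, if i + 2 < m + 2 then (floorConcavity F i).toNat else 0 : ℕ) : ℤ)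
      = ∑ i ∈ Finset.range m, floorConcavity F i := by
    push_cast
    refine Finset.sum_congr rfl fun i hi => ?_
    have hi := Finset.mem_range.1 hi
    rw [if_pos (by omega), Int.ofNat_toNat, max_eq_left (floorConcavity_nonneg (h1 i (by omega)))]
  rw [sum_floorConcavity] at e
  have a1 := (abs_le.1 (abs_floor_sub_floor_le (h3 m (by omega)))).1
  have a2 := (abs_le.1 (abs_floor_sub_floor_le (h3 0 (by omega)))).2
  have a3 := Nat.lt_floor_add_one (2 * Q)
  set T := (∑ i ∈ Finset.range m, if i + 2 < m + 2 then (floorConcavity F i).toNat else 0)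
  have e' : (T : ℝ) = m - ((⌊F (m + 1)⌋ - ⌊F m⌋ : ℤ) : ℝ) + ((⌊F (0 + 1)⌋ - ⌊F 0⌋ : ℤ) : ℝ) := by
    exact_mod_cast e
  have : (T : ℝ) < ((⌊2 * Q⌋₊ + (m + 2) + 1 : ℕ) : ℝ) := by push_cast; linarith
  exact (Nat.cast_lt.1 this).le

/-- Concave sequences are determined up to an error of `1` by the second differences of their integer
parts together with the first two of these. -/
theorem coded_concaveSlopeBounded {G : ℕ} (hG : 1 ≤ G) {P Q : ℝ} (hP : 0 ≤ P) (hQ : 0 ≤ Q) :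
    Coded (concaveSlopeBounded G P Q) (fun F F' => ∀ i < G, |F i - F' i| ≤ 1)
      (Real.log (2 * P + 2) + Real.log (2 * (Q + 1) + 2) +
        (3 * G + 2 * √(G * (2 * Q + G + 1)))) := by
  have h0 : Coded (concaveSlopeBounded G P Q) (fun F F' => ⌊F 0⌋ = ⌊F' 0⌋)
      (Real.log (2 * P + 2)) := by
    refine Coded.of_mapsTo (fun F => ⌊F 0⌋) (Finset.Icc ⌊-P⌋ ⌊P⌋) ?_ (log_card_Icc_floor_le hP)
      (Real.log_nonneg (by linarith)) fun _ _ _ _ h => h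
    rintro F ⟨-, h, -⟩
    rw [abs_le] at h
    exact Finset.mem_Icc.2 ⟨Int.floor_mono h.1, Int.floor_mono h.2⟩
  have h1 : Coded (concaveSlopeBounded G P Q)
      (fun F F' => 1 < G → ⌊F 1⌋ - ⌊F 0⌋ = ⌊F' 1⌋ - ⌊F' 0⌋) (Real.log (2 * (Q + 1) + 2)) := by
    refine Coded.of_mapsTo (fun F => if 1 < G then ⌊F 1⌋ - ⌊F 0⌋ else 0)
      (Finset.Icc ⌊-(Q + 1)⌋ ⌊Q + 1⌋) ?_ (log_card_Icc_floor_le (by linarith))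
      (Real.log_nonneg (by linarith)) ?_
    · rintro F ⟨-, -, h⟩
      have h' : |((if 1 < G then ⌊F 1⌋ - ⌊F 0⌋ else 0 : ℤ) : ℝ)| ≤ Q + 1 := by
        split_ifs with hG1
        · exact abs_floor_sub_floor_le (h 0 hG1)
        · simp; linarith
      rw [abs_le] at h'
      rw [Finset.mem_Icc]
      refine ⟨?_, Int.le_floor.2 h'.2⟩
      have := Int.floor_mono h'.1
      rwa [Int.floor_intCast] at this
    · intro F _ F' _ h hG1
      simpa [hG1] using h
  have h2 : Coded (concaveSlopeBounded G P Q)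
      (fun F F' => ∀ i, i + 2 < G → floorConcavity F i = floorConcavity F' i)
      (3 * G + 2 * √(G * (2 * Q + G + 1))) := by
    refine Coded.of_mapsTo (floorConcavityTuple G) (boundedTuples G (⌊2 * Q⌋₊ + G + 1))
      (fun F hF => floorConcavityTuple_mem hF) ?_ (by positivity) ?_
    · refine (log_card_boundedTuples_le hG (by omega)).trans ?_
      have := Nat.floor_le (show 0 ≤ 2 * Q by linarith)
      push_cast
      gcongr
    · intro F hF F' hF' h i hi
      have e := congrFun h ⟨i, by omega⟩
      simp only [floorConcavityTuple, hi, if_true] at e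
      have e1 := floorConcavity_nonneg (hF.1 i hi)
      have e2 := floorConcavity_nonneg (hF'.1 i hi)
      omega
  refine ((h0.and h1).and h2).mono ?_ le_rfl
  rintro F - F' - ⟨⟨e0, e1⟩, e2⟩ i hi
  have key : ∀ i, i < G → ⌊F i⌋ = ⌊F' i⌋ := by
    intro i
    induction i using Nat.strong_induction_on with
    | _ i ih =>
      intro hi
      match i, ih, hi with
      | 0, _, _ => exact e0
      | 1, _, hi => have := e1 hi; omega
      | j + 2, ih, hi =>
        have a := ih j (by omega) (by omega)
        have b := ih (j + 1) (by omega) (by omega)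
        have d := e2 j hi
        unfold floorConcavity at d
        omega
  exact (Int.abs_sub_lt_one_of_floor_eq_floor (key i hi)).le

/-! ### Slopes of concave sequences -/

section Slopes

variable {f : ℕ → ℝ} {D : ℝ} {y z : ℕ}

theorem sub_le_mul_of_slopes_le (hyz : y ≤ z) (h : ∀ i, y ≤ i → i < z → f (i + 1) - f i ≤ D) :
    f z - f y ≤ D * (z - y) := by
  induction z, hyz using Nat.le_induction with
  | base => simp
  | succ z hz ih =>
    have := ih fun i h1 h2 => h i h1 (by omega)
    have := h z hz (by omega)
    push_cast
    linarith

theorem mul_le_sub_of_le_slopes (hyz : y ≤ z) (h : ∀ i, y ≤ i → i < z → D ≤ f (i + 1) - f i) :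
    D * (z - y) ≤ f z - f y := by
  induction z, hyz using Nat.le_induction with
  | base => simp
  | succ z hz ih =>
    have := ih fun i h1 h2 => h i h1 (by omega)
    have := h z hz (by omega)
    push_cast
    linarith

theorem slope_antitone {N : ℕ} (hf : ∀ i, i + 2 < N → f i + f (i + 2) ≤ 2 * f (i + 1))
    (hyz : y ≤ z) (hz : z + 1 < N) : f (z + 1) - f z ≤ f (y + 1) - f y := by
  induction z, hyz using Nat.le_induction with
  | base => exact le_rfl
  | succ z hyz ih =>
    have := ih (by omega)
    have := hf z hz
    simp only [add_assoc, Nat.reduceAdd] at *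
    linarith

end Slopes

/-! ### Coding a piece by samples and Legendre transform -/

/-- Concave sequences of length `N` bounded by `B` with slopes bounded by `L`. -/
def concavePiece (N : ℕ) (B L : ℝ) : Set (ℕ → ℝ) :=
  {f | (∀ i, i + 2 < N → f i + f (i + 2) ≤ 2 * f (i + 1)) ∧ (∀ i < N, |f i| ≤ B) ∧
    ∀ i, i + 1 < N → |f (i + 1) - f i| ≤ L}

/-- The Legendre transform of a sequence of length `N`. -/
noncomputable def legendre (N : ℕ) (f : ℕ → ℝ) (s : ℝ) : ℝ := ⨆ i : Fin N, (f i - s * (i : ℕ))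

theorem le_legendre {N : ℕ} (f : ℕ → ℝ) (s : ℝ) {i : ℕ} (hi : i < N) :
    f i - s * i ≤ legendre N f s :=
  le_ciSup (f := fun i : Fin N => f i - s * (i : ℕ)) (Set.finite_range _).bddAbove ⟨i, hi⟩

theorem exists_legendre_eq {N : ℕ} (hN : 1 ≤ N) (f : ℕ → ℝ) (s : ℝ) :
    ∃ i < N, legendre N f s = f i - s * i := by
  have : Nonempty (Fin N) := ⟨⟨0, hN⟩⟩
  obtain ⟨i, hi⟩ := exists_eq_ciSup_of_finite (f := fun i : Fin N => f i - s * (i : ℕ))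
  exact ⟨i, i.2, hi.symm⟩

theorem legendre_sub_le {N : ℕ} (hN : 1 ≤ N) (f : ℕ → ℝ) (s t : ℝ) :
    legendre N f s - legendre N f t ≤ |s - t| * N := by
  obtain ⟨i, hi, e⟩ := exists_legendre_eq hN f s
  have h := le_legendre f t hi
  have h1 : (t - s) * i ≤ |s - t| * i := by
    rw [abs_sub_comm]; gcongr; exact le_abs_self _
  have h2 : |s - t| * i ≤ |s - t| * N := by gcongr
  linarith

theorem abs_legendre_sub_le {N : ℕ} (hN : 1 ≤ N) (f : ℕ → ℝ) (s t : ℝ) :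
    |legendre N f s - legendre N f t| ≤ |s - t| * N := by
  rw [abs_le]
  have h1 := legendre_sub_le hN f s t
  have h2 := legendre_sub_le hN f t s
  rw [abs_sub_comm] at h2
  constructor <;> linarith

theorem sampled_mem {N G h : ℕ} {B L δ : ℝ} {f : ℕ → ℝ} (hf : f ∈ concavePiece N B L)
    (hh : 1 ≤ h) (hG : ∀ i < G, i * h < N) (hG1 : 1 ≤ G) (hδ : 0 < δ) :
    (fun i => f (i * h) / δ) ∈ concaveSlopeBounded G (B / δ) (L * h / δ) := by
  obtain ⟨h1, h2, h3⟩ := hf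
  refine ⟨fun i hi => ?_, ?_, fun i hi => ?_⟩
  · have hN := hG (i + 2) hi
    have e1 : (i + 1) * h = i * h + h := by ring
    have e2 : (i + 2) * h = i * h + h + h := by ring
    rw [e2] at hN
    simp only [e1, e2]
    set a := i * h
    -- The slope at the middle grid point separates the slopes on the two adjacent cells.
    have k1 := sub_le_mul_of_slopes_le (f := f) (D := f (a + h + 1) - f (a + h))
      (show a + h ≤ a + h + h by omega)
      fun j hj hj' => slope_antitone h1 hj (by omega)
    have k2 := mul_le_sub_of_le_slopes (f := f) (D := f (a + h + 1) - f (a + h))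
      (show a ≤ a + h by omega)
      fun j hj hj' => slope_antitone h1 (by omega) (by omega)
    push_cast at k1 k2
    rw [← add_div, mul_div_assoc', div_le_div_iff_of_pos_right hδ]
    linarith
  · simp only [zero_mul]
    rw [abs_div, abs_of_pos hδ]
    have := hG 0 hG1
    gcongr
    exact h2 0 (by omega)
  · have hN := hG (i + 1) hi
    have e1 : (i + 1) * h = i * h + h := by ring
    rw [e1] at hN
    simp only [e1]
    set a := i * h
    have k1 := sub_le_mul_of_slopes_le (f := f) (D := L)
      (show a ≤ a + h by omega) fun j hj hj' => (abs_le.1 (h3 j (by omega))).2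
    have k2 := mul_le_sub_of_le_slopes (f := f) (D := -L)
      (show a ≤ a + h by omega) fun j hj hj' => (abs_le.1 (h3 j (by omega))).1
    push_cast at k1 k2
    rw [← sub_div, abs_div, abs_of_pos hδ]
    gcongr
    rw [abs_le]
    constructor <;> linarith

/-- A maximum of affine functions of the slope is convex, and it is `N`-Lipschitz since the indices
are below `N`. -/
theorem legendre_mem {N M : ℕ} {B L τ δ : ℝ} {f : ℕ → ℝ} (hf : f ∈ concavePiece N B L)
    (hN : 1 ≤ N) (hL : 0 ≤ L) (hτ : 0 ≤ τ) (hδ : 0 < δ) :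
    (fun j : ℕ => -legendre N f (-L + j * τ) / δ) ∈
      concaveSlopeBounded M ((B + L * N) / δ) (τ * N / δ) := by
  obtain ⟨h1, h2, h3⟩ := hf
  refine ⟨fun i hi => ?_, ?_, fun i hi => ?_⟩
  · obtain ⟨k, hk, e⟩ := exists_legendre_eq hN f (-L + ((i + 1 : ℕ) : ℝ) * τ)
    have a1 := le_legendre f (-L + (i : ℝ) * τ) hk
    have a2 := le_legendre f (-L + ((i + 2 : ℕ) : ℝ) * τ) hk
    rw [← add_div, mul_div_assoc', div_le_div_iff_of_pos_right hδ, e]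
    push_cast at *
    linarith
  · simp only [Nat.cast_zero, zero_mul, add_zero]
    rw [abs_div, abs_of_pos hδ, abs_neg]
    gcongr
    obtain ⟨k, hk, e⟩ := exists_legendre_eq hN f (-L)
    have a1 := le_legendre f (-L) (show 0 < N by omega)
    have a2 := abs_le.1 (h2 k hk)
    have a3 := abs_le.1 (h2 0 (by omega))
    have a4 : L * k ≤ L * N := by gcongr
    have a5 : 0 ≤ L * N := by positivity
    rw [abs_le]
    simp at a1
    constructor <;> linarith
  · rw [← sub_div, abs_div, abs_of_pos hδ]
    gcongr
    rw [neg_sub_neg]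
    refine (abs_legendre_sub_le hN _ _ _).trans (le_of_eq ?_)
    push_cast
    rw [show -L + (i : ℝ) * τ - (-L + (i + 1) * τ) = -τ by ring, abs_neg, abs_of_nonneg hτ]

/-- If the left slope `p` of `f` at `x` lies in `[s - τ, s]`, then the Legendre transform at `s`
and the values at the two grid points before `x` bound from above any concave `g` at `x` in terms
of `f x`. -/
theorem le_add_of_legendre_close {N h a x : ℕ} {B L δ τ s : ℝ} {f g : ℕ → ℝ}
    (hf : f ∈ concavePiece N B L) (hg : g ∈ concavePiece N B L)
    (hax : a < x) (hxa : x < a + h) (hx : x < N) (hτ : 0 ≤ τ) (hδ : 0 ≤ δ)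
    (hp : f x - f (x - 1) ≤ s) (hp' : s - τ ≤ f x - f (x - 1))
    (hleg : |legendre N f s - legendre N g s| ≤ δ) (ha : |f a - g a| ≤ δ)
    (ha' : h ≤ a → |f (a - h) - g (a - h)| ≤ δ) :
    g x ≤ f x + 2 * (τ * h) + 3 * δ := by
  obtain ⟨f1, -, -⟩ := hf
  obtain ⟨g1, -, -⟩ := hg
  set p := f x - f (x - 1) with hpdef
  have hx1 : x - 1 + 1 = x := by omega
  have hpx : ∀ i, i < x → p ≤ f (i + 1) - f i := fun i hi => by
    have := slope_antitone f1 (show i ≤ x - 1 by omega) (by omega)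
    rwa [hx1] at this
  have hxp : ∀ i, x ≤ i → i + 1 < N → f (i + 1) - f i ≤ p := fun i hi hi' => by
    have := slope_antitone f1 (show x - 1 ≤ i by omega) hi'
    rwa [hx1] at this
  -- Slopes from `x` on are at most `p ≤ s`, so a maximiser beyond `x` may be replaced by `x`.
  obtain ⟨y, hyx, ey⟩ : ∃ y ≤ x, legendre N f s = f y - s * y := by
    obtain ⟨y, hy, ey⟩ := exists_legendre_eq (show 1 ≤ N by omega) f s
    rcases le_or_gt y x with h | h
    · exact ⟨y, h, ey⟩
    · refine ⟨x, le_rfl, le_antisymm ?_ (le_legendre f s hx)⟩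
      have := sub_le_mul_of_slopes_le (f := f) (D := s) h.le
        fun i hi hi' => (hxp i hi (by omega)).trans hp
      linarith
  have hgx := le_legendre g s hx
  rw [abs_le] at hleg ha
  rcases le_or_gt a (y + h) with hy | hy
  · have k := mul_le_sub_of_le_slopes (f := f) (D := s - τ) hyx
      fun i _ hi' => hp'.trans (hpx i hi')
    have hd : (x : ℝ) - y ≤ 2 * h := by
      have : (x : ℝ) ≤ y + 2 * h := by exact_mod_cast (show x ≤ y + 2 * h by omega)
      linarith
    have := mul_le_mul_of_nonneg_left hd hτ
    linarith [hleg.1]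
  -- `y` lies before the previous grid point `b`, so `f` has slopes at most `s` on the cell from `b`
  -- to `a`. Closeness at both ends bounds the slope `D` of `g` at `a`, and concavity of `g` carries
  -- this bound on to `x`.
  · have ha' := abs_le.1 (ha' (by omega))
    obtain ⟨b, rfl⟩ : ∃ b, a = b + h := ⟨a - h, by omega⟩
    rw [Nat.add_sub_cancel] at ha'
    have hh : 1 ≤ h := by omega
    have hys : f (y + 1) - f y ≤ s := by
      have := le_legendre f s (show y + 1 < N by omega)
      push_cast at this
      linarith
    have k1 := sub_le_mul_of_slopes_le (f := f) (D := s) (show b ≤ b + h by omega)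
      fun i hi hi' => (slope_antitone f1 (show y ≤ i by omega) (by omega)).trans hys
    set D := g (b + h + 1) - g (b + h) with hD
    have k2 := mul_le_sub_of_le_slopes (f := g) (D := D) (show b ≤ b + h by omega)
      fun i hi hi' => slope_antitone g1 (show i ≤ b + h by omega) (by omega)
    have k3 := sub_le_mul_of_slopes_le (f := g) (D := D) (show b + h ≤ x by omega)
      fun i hi hi' => slope_antitone g1 (show b + h ≤ i by omega) (by omega)
    have k4 := mul_le_sub_of_le_slopes (f := f) (D := s - τ) (show b + h ≤ x by omega)
      fun i _ hi' => hp'.trans (hpx i hi')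
    have hh' : (0 : ℝ) < h := by exact_mod_cast hh
    have hxb : (x : ℝ) - (b + h) ≤ h := by
      have : (x : ℝ) ≤ b + h + h := by exact_mod_cast hxa.le
      linarith
    have hxb0 : 0 ≤ (x : ℝ) - (b + h) := by
      have : ((b + h : ℕ) : ℝ) ≤ x := by exact_mod_cast hax.le
      push_cast at this
      linarith
    push_cast at k1 k2 k3 k4
    have k5 : (D - s) * h ≤ 2 * δ := by linarith [ha.1, ha'.2]
    have k6 : (D - s) * (x - (b + h)) ≤ 2 * δ := by
      rcases le_total (D - s) 0 with hn | hn
      · exact (mul_nonpos_of_nonpos_of_nonneg hn hxb0).trans (by linarith)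
      · exact (mul_le_mul_of_nonneg_left hxb hn).trans k5
    have k7 := mul_le_mul_of_nonneg_left hxb hτ
    have k8 : 0 ≤ τ * h := by positivity
    linarith [ha.1]

/-- The bound on `G * Q` is what keeps the square root linear in `M`; `Q` alone may be of order `M ^
2`. -/
theorem coding_cost_le {G M P Q : ℝ} (hG0 : 0 ≤ G) (hM : 1 ≤ M) (hP0 : 0 ≤ P) (hQ0 : 0 ≤ Q)
    (hG : G ≤ 2 * M) (hP : P ≤ 3 * M ^ 2) (hQ : Q ≤ 4 * M ^ 2) (hGQ : G * Q ≤ 8 * M ^ 2) :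
    Real.log (2 * P + 2) + Real.log (2 * (Q + 1) + 2) +
        (3 * G + 2 * √(G * (2 * Q + G + 1))) ≤ 30 * M := by
  have h1 : Real.log (2 * P + 2) ≤ 6 * M := by
    have : √(2 * P + 2) ≤ 3 * M := Real.sqrt_le_iff.2 ⟨by linarith, by nlinarith⟩
    linarith [log_le_two_mul_sqrt (show 0 < 2 * P + 2 by linarith)]
  have h2 : Real.log (2 * (Q + 1) + 2) ≤ 8 * M := by
    have : √(2 * (Q + 1) + 2) ≤ 4 * M := Real.sqrt_le_iff.2 ⟨by linarith, by nlinarith⟩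
    linarith [log_le_two_mul_sqrt (show 0 < 2 * (Q + 1) + 2 by linarith)]
  have h3 : √(G * (2 * Q + G + 1)) ≤ 5 * M :=
    Real.sqrt_le_iff.2 ⟨by linarith, by nlinarith⟩
  linarith

/-- Samples and Legendre values cost `30 * M` each. With `τ * h ≤ 4 * δ`, the error `2 * (τ * h) + 3
* δ` is at most `11 * δ`. -/
theorem coded_concavePiece_nat {N M : ℕ} {B L : ℝ} (hN : 1 ≤ N) (hM : 1 ≤ M) (hB : 0 < B)
    (hL : 0 < L) (hNL : N * L ≤ 2 * B) :
    Coded (concavePiece N B L) (fun f g => ∀ i < N, |f i - g i| ≤ 11 * (B / M ^ 2))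
      (60 * M) := by
  have hM' : (1 : ℝ) ≤ M := by exact_mod_cast hM
  have hN' : (1 : ℝ) ≤ N := by exact_mod_cast hN
  set δ : ℝ := B / M ^ 2 with hδ
  set τ : ℝ := 2 * L / M with hτ
  -- If `N / M` is `0`, every index is a sample and no interpolation is needed.
  set h : ℕ := max 1 (N / M) with hh
  set G : ℕ := (N - 1) / h + 1 with hG
  have hδ0 : 0 < δ := by positivity
  have hτ0 : 0 < τ := by positivity
  have hh1 : 1 ≤ h := le_max_left _ _
  have hhN : h ≤ N := max_le hN (Nat.div_le_self _ _)
  have hhM : h = 1 ∨ h * M ≤ N := by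
    rcases le_total 1 (N / M) with h1 | h1
    · right; rw [hh, max_eq_right h1]; exact Nat.div_mul_le_self _ _
    · left; rw [hh, max_eq_left h1]
  have hGM : G ≤ 2 * M := by
    have h1 : N < 2 * M * h := by
      have a := Nat.lt_div_mul_add (a := N) (b := M) (by omega)
      have b : N / M ≤ h := le_max_right _ _
      nlinarith
    have : (N - 1) / h < 2 * M := Nat.div_lt_of_lt_mul (by rw [mul_comm]; omega)
    omega
  have hG1 : 1 ≤ G := Nat.succ_pos _
  have hGh : ∀ i < G, i * h < N := fun i hi => by
    have a : i * h ≤ (N - 1) / h * h := Nat.mul_le_mul_right _ (by omega)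
    have b := Nat.div_mul_le_self (N - 1) h
    omega
  have hGhN : G * h ≤ 2 * N := by
    have b := Nat.div_mul_le_self (N - 1) h
    rw [hG, add_mul, one_mul]; omega
  have hδi : ∀ t : ℝ, t / δ = t / B * M ^ 2 := fun t => by rw [hδ]; field_simp
  have hLN : L * N / B ≤ 2 := by rw [div_le_iff₀ hB]; linarith
  have hhN' : (h : ℝ) ≤ N := by exact_mod_cast hhN
  have hGM' : (G : ℝ) ≤ 2 * M := by exact_mod_cast hGM
  have hGhN' : (G : ℝ) * h ≤ 2 * N := by exact_mod_cast hGhN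
  have c1 : Coded (concavePiece N B L) (fun f g => ∀ i < G, |f (i * h) / δ - g (i * h) / δ| ≤ 1)
      (30 * M) := by
    refine (((coded_concaveSlopeBounded (G := G) (P := B / δ) (Q := L * h / δ) hG1
      (by positivity) (by positivity)).comap (fun f i => f (i * h) / δ)
      fun f hf => sampled_mem hf hh1 hGh hG1 hδ0)).mono (fun _ _ _ _ h => h) ?_
    refine coding_cost_le (by positivity) hM' (by positivity) (by positivity) hGM' ?_ ?_ ?_
    · rw [hδi, div_self hB.ne']; nlinarith
    · rw [hδi]
      gcongr
      have : L * h / B ≤ L * N / B := by gcongr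
      linarith
    · rw [hδi, ← mul_assoc]
      gcongr
      have : G * (L * h / B) = L * (G * h) / B := by ring
      rw [this]
      have : L * (G * h) / B ≤ L * (2 * N) / B := by gcongr
      have e : L * (2 * N) / B = 2 * (L * N / B) := by ring
      linarith
  have c2 : Coded (concavePiece N B L) (fun f g => ∀ j < M + 1,
      |-legendre N f (-L + j * τ) / δ - -legendre N g (-L + j * τ) / δ| ≤ 1) (30 * M) := by
    refine (((coded_concaveSlopeBounded (G := M + 1) (P := (B + L * N) / δ) (Q := τ * N / δ)
      (by omega) (by positivity) (by positivity)).comap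
      (fun f (j : ℕ) => -legendre N f (-L + j * τ) / δ)
      fun f hf => legendre_mem hf hN hL.le hτ0.le hδ0)).mono (fun _ _ _ _ h => h) ?_
    have hQ : τ * N / δ = 2 * (L * N / B) * M := by rw [hδi, hτ]; field_simp
    have hQ' : τ * N / δ ≤ 4 * M := by rw [hQ]; gcongr; linarith
    have hQ0 : 0 ≤ τ * N / δ := by positivity
    push_cast
    refine coding_cost_le (by positivity) hM' (by positivity) hQ0 (by linarith) ?_ ?_ ?_
    · rw [hδi, add_div, div_self hB.ne']
      gcongr
      linarith
    · nlinarith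
    · nlinarith
  refine (c1.and c2).mono ?_ (by linarith)
  rintro f hf g hg ⟨e1, e2⟩ x hx
  have e1 : ∀ i < G, |f (i * h) - g (i * h)| ≤ δ := fun i hi => by
    have := e1 i hi
    rwa [← sub_div, abs_div, abs_of_pos hδ0, div_le_one hδ0] at this
  have e2 : ∀ j < M + 1, |legendre N f (-L + j * τ) - legendre N g (-L + j * τ)| ≤ δ :=
    fun j hj => by
      have := e2 j hj
      rwa [← sub_div, abs_div, abs_of_pos hδ0, div_le_one hδ0, neg_sub_neg, abs_sub_comm] at this
  have hq : x / h < G := by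
    have : x / h ≤ (N - 1) / h := Nat.div_le_div_right (by omega)
    omega
  set a := x / h * h with ha
  have hax : a ≤ x := Nat.div_mul_le_self _ _
  have hxa : x < a + h := Nat.lt_div_mul_add (by omega)
  rcases hax.eq_or_lt with hax' | hax'
  · have := e1 _ hq
    rw [← ha, hax'] at this
    linarith
  have hτh : τ * h ≤ 4 * δ := by
    have hhM : h * M ≤ N := hhM.resolve_left (by omega)
    have hhM' : (h : ℝ) * M ≤ N := by exact_mod_cast hhM
    rw [hτ, hδ, div_mul_eq_mul_div, mul_div_assoc', div_le_div_iff₀ (by positivity) (by positivity)]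
    have : L * (h * M) ≤ L * N := by gcongr
    have : 2 * (L * (h * M)) * M ≤ 4 * B * M :=
      mul_le_mul_of_nonneg_right (by linarith) (by positivity)
    linarith
  have key : ∀ f ∈ concavePiece N B L, ∀ g ∈ concavePiece N B L,
      (∀ i < G, |f (i * h) - g (i * h)| ≤ δ) →
      (∀ j < M + 1, |legendre N f (-L + j * τ) - legendre N g (-L + j * τ)| ≤ δ) →
      g x ≤ f x + 11 * δ := by
    intro f hf g hg e1 e2
    have hp := hf.2.2 (x - 1) (by omega)
    rw [show x - 1 + 1 = x by omega] at hp
    rw [abs_le] at hp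
    set p := f x - f (x - 1) with hpdef
    have hj0 : 0 ≤ (p + L) / τ := div_nonneg (by linarith) hτ0.le
    -- The first grid slope not below `p`; it exceeds `p` by at most `τ`.
    set j := ⌈(p + L) / τ⌉₊ with hj
    have hj1 : p + L ≤ j * τ := by
      rw [← div_le_iff₀ hτ0]; exact Nat.le_ceil _
    have hj2 : j * τ ≤ p + L + τ := by
      have := (Nat.ceil_lt_add_one hj0).le
      rw [div_add_one hτ0.ne', le_div_iff₀ hτ0] at this
      exact this
    have hjM : j ≤ M := by
      rw [hj, Nat.ceil_le, div_le_iff₀ hτ0, hτ]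
      have : (M : ℝ) * (2 * L / M) = 2 * L := by field_simp
      linarith
    have := le_add_of_legendre_close (δ := δ) (τ := τ) hf hg hax' hxa hx hτ0.le hδ0.le
      (s := -L + j * τ) (by linarith) (by linarith) (e2 j (by omega)) (e1 _ hq) fun hle => by
        have h0 : x / h ≠ 0 := by rintro h0; rw [h0] at ha; omega
        have := e1 (x / h - 1) ((Nat.sub_le _ _).trans_lt hq)
        rwa [Nat.sub_mul, one_mul, ← ha] at this
    linarith
  have k1 := key f hf g hg e1 e2
  have k2 := key g hg f hf (fun i hi => by rw [abs_sub_comm]; exact e1 i hi)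
    fun i hi => by rw [abs_sub_comm]; exact e2 i hi
  rw [abs_le]
  constructor <;> linarith

/-- Dyadic budgets are real and may drop below `1`, where the trivial error `2 * B` suffices.
Otherwise `⌊X⌋₊ ≥ X / 2` costs a factor `4`. -/
theorem coded_concavePiece {N : ℕ} {B L X : ℝ} (hN : 1 ≤ N) (hB : 0 < B)
    (hL : 0 < L) (hNL : N * L ≤ 2 * B) (hX : 0 < X) :
    Coded (concavePiece N B L) (fun f g => ∀ i < N, |f i - g i| ≤ 44 * (B / X ^ 2))
      (60 * X) := by
  rcases lt_or_ge X 1 with h1 | h1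
  · refine Coded.of_forall (fun f hf g hg i hi => ?_) (by positivity)
    have a := abs_le.1 (hf.2.1 i hi)
    have b := abs_le.1 (hg.2.1 i hi)
    have : B ≤ B / X ^ 2 := by
      rw [le_div_iff₀ (by positivity)]
      exact mul_le_of_le_one_right hB.le (pow_le_one₀ hX.le h1.le)
    rw [abs_le]
    constructor <;> linarith
  · have hf := Nat.floor_le hX.le
    have hf' := Nat.lt_floor_add_one X
    have hM : 1 ≤ ⌊X⌋₊ := Nat.le_floor (by simpa using h1)
    have hM' : (1 : ℝ) ≤ ⌊X⌋₊ := by exact_mod_cast hM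
    refine (coded_concavePiece_nat hN hM hB hL hNL).mono (fun f _ g _ h i hi => ?_) (by linarith)
    refine (h i hi).trans ?_
    have : B / (⌊X⌋₊ : ℝ) ^ 2 ≤ B / (X / 2) ^ 2 := by
      gcongr; linarith
    have e : B / (X / 2) ^ 2 = 4 * (B / X ^ 2) := by field_simp; norm_num
    linarith

/-! ### Dyadic blocks and the two halves -/

/-- Concave sequences of length `n` bounded by `B` with slopes of order at most `B` over the distance
to the left end. -/
def concaveHalf (n : ℕ) (B : ℝ) : Set (ℕ → ℝ) :=
  {f | (∀ i, i + 2 < n → f i + f (i + 2) ≤ 2 * f (i + 1)) ∧ (∀ i < n, |f i| ≤ B) ∧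
    ∀ i, i + 1 < n → |f (i + 1) - f i| ≤ 2 * B / (i + 1)}

theorem dyadic_piece_mem {n k : ℕ} {B : ℝ} (hB : 0 ≤ B) {f : ℕ → ℝ} (hf : f ∈ concaveHalf n B) :
    (fun i => f (2 ^ k - 1 + i)) ∈
      concavePiece (min (2 ^ k) (n - (2 ^ k - 1))) B (2 * B / 2 ^ k) := by
  obtain ⟨h1, h2, h3⟩ := hf
  have hk : 1 ≤ 2 ^ k := Nat.one_le_two_pow
  refine ⟨fun i hi => h1 (2 ^ k - 1 + i) (by omega), fun i hi => h2 (2 ^ k - 1 + i) (by omega),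
    fun i hi => ?_⟩
  refine (h3 (2 ^ k - 1 + i) (by omega)).trans ?_
  gcongr
  have : ((2 ^ k : ℕ) : ℝ) ≤ ((2 ^ k - 1 + i + 1 : ℕ) : ℝ) := by
    exact_mod_cast (by omega : 2 ^ k ≤ 2 ^ k - 1 + i + 1)
  push_cast at this
  simpa using this

theorem sum_range_two_pow_sub_one (e : ℕ → ℝ) (K : ℕ) :
    ∑ i ∈ Finset.range (2 ^ K - 1), e i =
      ∑ k ∈ Finset.range K, ∑ i ∈ Finset.range (2 ^ k), e (2 ^ k - 1 + i) := by
  induction K with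
  | zero => simp
  | succ K ih =>
    have : 1 ≤ 2 ^ K := Nat.one_le_two_pow
    rw [Finset.sum_range_succ, ← ih, ← Finset.sum_range_add]
    congr 2
    rw [pow_succ]; omega

theorem sum_pow_sub_le {q : ℝ} (h0 : 0 ≤ q) (h1 : q < 1) (K : ℕ) :
    ∑ k ∈ Finset.range (K + 1), q ^ (K - k) ≤ (1 - q)⁻¹ := by
  have := Finset.sum_range_reflect (fun k => q ^ k) (K + 1)
  simp only [Nat.add_sub_cancel] at this
  rw [this, ← tsum_geometric_of_lt_one h0 h1]
  exact (summable_geometric_of_lt_one h0 h1).sum_le_tsum _ fun _ _ => by positivity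

theorem coded_concaveHalf {n : ℕ} {B X : ℝ} (hn : 1 ≤ n) (hB : 0 < B) (hX : 0 < X) :
    Coded (concaveHalf n B)
      (fun f g => ∑ i ∈ Finset.range n, (f i - g i) ^ 2 ≤ 4 * n * (44 * (B / X ^ 2)) ^ 2)
      (660 * X) := by
  set K := Nat.log2 n with hK
  have hKn : 2 ^ K ≤ n := Nat.log2_self_le (by omega)
  have hnK : n < 2 ^ (K + 1) := Nat.lt_log2_self
  have hKn' : (2 : ℝ) ^ K ≤ n := by exact_mod_cast hKn
  -- Any ratio `r < 1` with `2 * r ^ 4 > 1` would do: costs decay like `r ^ (K - k)` and squared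
  -- errors like `(2 * r ^ 4)⁻¹ ^ (K - k)`. Here the latter ratio is `14641 / 20000`.
  have hpiece : ∀ k < K + 1, Coded (concaveHalf n B)
      (fun f g => ∀ i < min (2 ^ k) (n - (2 ^ k - 1)),
        |f (2 ^ k - 1 + i) - g (2 ^ k - 1 + i)| ≤ 44 * (B / (X * (10 / 11) ^ (K - k)) ^ 2))
      (60 * (X * (10 / 11) ^ (K - k))) := by
    intro k hk
    have hk1 : 1 ≤ 2 ^ k := Nat.one_le_two_pow
    have hk2 : 2 ^ k ≤ 2 ^ K := Nat.pow_le_pow_right (by omega) (by omega)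
    refine (coded_concavePiece (N := min (2 ^ k) (n - (2 ^ k - 1))) (B := B) (L := 2 * B / 2 ^ k)
      (X := X * (10 / 11) ^ (K - k))
      (le_min hk1 (by omega)) hB (by positivity) ?_ (by positivity)).comap
      (fun f i => f (2 ^ k - 1 + i)) fun f hf => dyadic_piece_mem hB.le hf
    have : ((min (2 ^ k) (n - (2 ^ k - 1)) : ℕ) : ℝ) ≤ 2 ^ k := by
      exact_mod_cast min_le_left _ _
    calc _ ≤ (2 : ℝ) ^ k * (2 * B / 2 ^ k) := by gcongr
      _ = 2 * B := by field_simp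
  refine (Coded.pi hpiece).mono ?_ ?_
  · intro f _ g _ h
    set e : ℕ → ℝ := fun i => if i < n then (f i - g i) ^ 2 else 0 with he
    have he0 : ∀ i, 0 ≤ e i := fun i => by rw [he]; dsimp only; split_ifs <;> positivity
    have hterm : ∀ k ∈ Finset.range (K + 1), ∑ i ∈ Finset.range (2 ^ k), e (2 ^ k - 1 + i) ≤
        (44 * (B / X ^ 2)) ^ 2 * 2 ^ K * (14641 / 20000) ^ (K - k) := by
      intro k hk
      have hk := Finset.mem_range.1 hk
      have hle : ∀ i ∈ Finset.range (2 ^ k), e (2 ^ k - 1 + i) ≤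
          (44 * (B / (X * (10 / 11) ^ (K - k)) ^ 2)) ^ 2 := by
        intro i hi
        have hi := Finset.mem_range.1 hi
        rw [he]
        dsimp only
        split_ifs with hin
        · rw [← sq_abs]
          exact pow_le_pow_left₀ (abs_nonneg _) (h k hk i (lt_min hi (by omega))) 2
        · positivity
      refine (Finset.sum_le_sum hle).trans (le_of_eq ?_)
      rw [Finset.sum_const, Finset.card_range, nsmul_eq_mul]
      obtain ⟨j, hj⟩ : ∃ j, K = k + j := ⟨K - k, by omega⟩
      rw [hj, Nat.add_sub_cancel_left, pow_add,
        show (14641 / 20000 : ℝ) = 2⁻¹ * ((10 / 11) ^ 4)⁻¹ by norm_num, mul_pow 2⁻¹, inv_pow, inv_pow,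
        ← pow_mul, mul_comm 4 j, pow_mul]
      push_cast
      generalize ((10 : ℝ) / 11) ^ j = y
      field_simp
    calc ∑ i ∈ Finset.range n, (f i - g i) ^ 2 = ∑ i ∈ Finset.range n, e i :=
          Finset.sum_congr rfl fun i hi => by rw [he]; simp [Finset.mem_range.1 hi]
      _ ≤ ∑ i ∈ Finset.range (2 ^ (K + 1) - 1), e i :=
          Finset.sum_le_sum_of_subset_of_nonneg (Finset.range_mono (by omega)) fun _ _ _ => he0 _
      _ ≤ ∑ k ∈ Finset.range (K + 1), (44 * (B / X ^ 2)) ^ 2 * 2 ^ K * (14641 / 20000) ^ (K - k) :=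
          (sum_range_two_pow_sub_one e _).trans_le (Finset.sum_le_sum hterm)
      _ ≤ (44 * (B / X ^ 2)) ^ 2 * n * 4 := by
          rw [← Finset.mul_sum]
          gcongr
          exact (sum_pow_sub_le (by norm_num) (by norm_num) K).trans (by norm_num)
      _ = _ := by ring
  · rw [← Finset.mul_sum, ← Finset.mul_sum]
    have := sum_pow_sub_le (q := 10 / 11) (by norm_num) (by norm_num) K
    have e : (1 - 10 / 11 : ℝ)⁻¹ = 11 := by norm_num
    rw [e] at this
    have := mul_le_mul_of_nonneg_left this hX.le
    linarith

/-- A slope `D ≥ 0` persists back to the left end, and `D < 0` persists to the right end, which is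
at least as far away in the left half. The variation is at most `2 * B` either way. -/
theorem mem_concaveHalf {n : ℕ} {B : ℝ} {f : ℕ → ℝ}
    (h1 : ∀ i, i + 2 < n → f i + f (i + 2) ≤ 2 * f (i + 1)) (h2 : ∀ i < n, |f i| ≤ B) :
    f ∈ concaveHalf ((n + 1) / 2) B := by
  refine ⟨fun i hi => h1 i (by omega), fun i hi => h2 i (by omega), fun i hi => ?_⟩
  set D := f (i + 1) - f i with hD
  have a0 := abs_le.1 (h2 0 (by omega))
  have a1 := abs_le.1 (h2 i (by omega))
  have a2 := abs_le.1 (h2 (i + 1) (by omega))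
  have a3 := abs_le.1 (h2 (n - 1) (by omega))
  have k1 := mul_le_sub_of_le_slopes (f := f) (D := D) (show 0 ≤ i + 1 by omega)
    fun j _ hj => slope_antitone h1 (by omega) (by omega)
  have k2 := sub_le_mul_of_slopes_le (f := f) (D := D) (show i ≤ n - 1 by omega)
    fun j hj _ => slope_antitone h1 hj (by omega)
  have hi0 : (0 : ℝ) < i + 1 := by positivity
  rw [le_div_iff₀ hi0]
  push_cast at k1
  have hn : (i : ℝ) + 1 ≤ (n - 1 : ℕ) - i := by
    have : ((i + 1 + i : ℕ) : ℝ) ≤ ((n - 1 : ℕ) : ℝ) := by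
      exact_mod_cast (by omega : i + 1 + i ≤ n - 1)
    push_cast at this ⊢
    linarith
  rcases abs_cases D with ⟨e, -⟩ | ⟨e, hneg⟩
  · rw [e]; linarith
  · rw [e]
    have := mul_le_mul_of_nonpos_left hn hneg.le
    linarith

theorem sum_range_le_sum_halves (e : ℕ → ℝ) (he : ∀ i, 0 ≤ e i) (n : ℕ) :
    ∑ i ∈ Finset.range n, e i ≤ ∑ i ∈ Finset.range ((n + 1) / 2), e i +
      ∑ i ∈ Finset.range ((n + 1) / 2), e (n - 1 - i) := by
  obtain ⟨m, hm⟩ : ∃ m, n = (n + 1) / 2 + m := ⟨n - (n + 1) / 2, by omega⟩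
  conv_lhs => rw [hm, Finset.sum_range_add]
  gcongr
  rw [← Finset.sum_range_reflect]
  calc _ = ∑ i ∈ Finset.range m, e (n - 1 - i) :=
        Finset.sum_congr rfl fun i hi => by
          have := Finset.mem_range.1 hi
          congr 1
          omega
    _ ≤ _ := Finset.sum_le_sum_of_subset_of_nonneg (Finset.range_mono (by omega))
        fun _ _ _ => he _

/-! ### Covering numbers in Euclidean space -/

theorem Coded.coveringNumber_le {α : Type} [PseudoMetricSpace α] {S : Set α} {ε : ℝ≥0} {b : ℝ}
    (h : Coded S (fun x y => dist x y ≤ ε) b) :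
    Metric.coveringNumber ε S ≠ ⊤ ∧ Real.log ((Metric.coveringNumber ε S).toNat : ℝ) ≤ b := by
  classical
  obtain ⟨ι, i1, i2, c, hb, h⟩ := h
  have hrep : ∀ k : (c '' S : Set ι), ∃ x ∈ S, c x = k := fun k => k.2
  choose rep hrS hrc using hrep
  -- Only labels attained on `S` get a representative, so all centres lie in `S`.
  have hcover : Metric.IsCover ε S (Set.range rep) := by
    intro x hx
    refine ⟨rep ⟨c x, x, hx, rfl⟩, ⟨_, rfl⟩, ?_⟩
    have := h x hx _ (hrS ⟨c x, x, hx, rfl⟩) (hrc ⟨c x, x, hx, rfl⟩).symm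
    change edist _ _ ≤ _
    rw [edist_dist]
    exact ENNReal.ofReal_le_of_le_toReal (by simpa using this)
  have hle : Metric.coveringNumber ε S ≤ (Fintype.card ι : ℕ∞) := by
    refine (hcover.coveringNumber_le_encard (by rintro _ ⟨k, rfl⟩; exact hrS k)).trans ?_
    rw [← Set.image_univ]
    refine (Set.encard_image_le _ _).trans ?_
    rw [Set.encard_univ, ENat.card_eq_coe_fintype_card]
    exact_mod_cast Fintype.card_subtype_le _
  refine ⟨ne_top_of_le_ne_top (ENat.natCast_ne_top _) hle, le_trans ?_ hb⟩
  have hle' : (Metric.coveringNumber ε S).toNat ≤ Fintype.card ι :=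
    ENat.toNat_le_of_le_natCast hle
  rcases Nat.eq_zero_or_pos (Metric.coveringNumber ε S).toNat with h0 | h0
  · rw [h0]
    simpa using Real.log_natCast_nonneg _
  · exact Real.log_le_log (by exact_mod_cast h0) (by exact_mod_cast hle')

/-- Extension of a vector to a sequence by zero. -/
def extendZero {n : ℕ} (θ : EuclideanSpace ℝ (Fin n)) (i : ℕ) : ℝ :=
  if h : i < n then θ ⟨i, h⟩ else 0

theorem extendZero_of_lt {n : ℕ} (θ : EuclideanSpace ℝ (Fin n)) {i : ℕ} (h : i < n) :
    extendZero θ i = θ ⟨i, h⟩ := dif_pos h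

theorem extendZero_concave {n : ℕ} {θ : EuclideanSpace ℝ (Fin n)} (hθ : θ ∈ concaveSeq n) (i : ℕ)
    (hi : i + 2 < n) : extendZero θ i + extendZero θ (i + 2) ≤ 2 * extendZero θ (i + 1) := by
  rw [extendZero_of_lt θ (by omega : i < n), extendZero_of_lt θ hi,
    extendZero_of_lt θ (by omega : i + 1 < n)]
  have := hθ i hi
  linarith

theorem extendZero_mem_concaveHalf {n : ℕ} {B : ℝ} {θ : EuclideanSpace ℝ (Fin n)}
    (hθ : θ ∈ boundedConcaveSeq n B) : extendZero θ ∈ concaveHalf ((n + 1) / 2) B :=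
  mem_concaveHalf (extendZero_concave hθ.1)
    fun i hi => by rw [extendZero_of_lt θ hi]; exact hθ.2 _

theorem extendZero_reflect_mem_concaveHalf {n : ℕ} {B : ℝ} {θ : EuclideanSpace ℝ (Fin n)}
    (hθ : θ ∈ boundedConcaveSeq n B) :
    (fun i => extendZero θ (n - 1 - i)) ∈ concaveHalf ((n + 1) / 2) B := by
  refine mem_concaveHalf (fun i hi => ?_) fun i hi => ?_
  · have := extendZero_concave hθ.1 (n - 1 - (i + 2)) (by omega)
    rw [show n - 1 - (i + 2) + 2 = n - 1 - i by omega,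
      show n - 1 - (i + 2) + 1 = n - 1 - (i + 1) by omega] at this
    linarith
  · rw [extendZero_of_lt θ (by omega : n - 1 - i < n)]
    exact hθ.2 _

theorem dist_sq_eq_sum_range {n : ℕ} (θ φ : EuclideanSpace ℝ (Fin n)) :
    dist θ φ ^ 2 = ∑ i ∈ Finset.range n, (extendZero θ i - extendZero φ i) ^ 2 := by
  rw [EuclideanSpace.dist_eq, Real.sq_sqrt (by positivity), Finset.sum_range]
  refine Finset.sum_congr rfl fun i _ => ?_
  rw [extendZero_of_lt θ i.2, extendZero_of_lt φ i.2, Real.dist_eq, sq_abs]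

theorem coded_boundedConcaveSeq {n : ℕ} {B X ε : ℝ} (hn : 1 ≤ n) (hB : 0 < B) (hX : 0 < X)
    (hε : 0 < ε) (hXε : 8 * n * (44 * (B / X ^ 2)) ^ 2 ≤ ε ^ 2) :
    Coded (boundedConcaveSeq n B) (fun θ φ => dist θ φ ≤ ε) (1320 * X) := by
  have hhalf := coded_concaveHalf (n := (n + 1) / 2) (by omega) hB hX
  refine ((hhalf.comap extendZero fun θ hθ => extendZero_mem_concaveHalf hθ).and
    (hhalf.comap (fun (θ : EuclideanSpace ℝ (Fin n)) i => extendZero θ (n - 1 - i))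
      fun θ hθ => extendZero_reflect_mem_concaveHalf hθ)).mono ?_ (by linarith)
  rintro θ - φ - ⟨h1, h2⟩
  refine (sq_le_sq₀ dist_nonneg hε.le).1 ?_
  rw [dist_sq_eq_sum_range]
  refine (sum_range_le_sum_halves _ (fun _ => sq_nonneg _) n).trans ?_
  have hn' : (((n + 1) / 2 : ℕ) : ℝ) ≤ n := by exact_mod_cast (by omega : (n + 1) / 2 ≤ n)
  have := mul_le_mul_of_nonneg_right hn' (sq_nonneg (44 * (B / X ^ 2)))
  linarith

/-- `Metric.coveringNumber ε A : ℕ∞` is the least number of closed balls of radius `ε` with centres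
in `A` that cover `A`. It is finite here, and its logarithm satisfies the bound. -/
theorem lemma3p6 :
    ∃ C : ℝ, 0 < C ∧
      ∀ (n : ℕ), 3 ≤ n → ∀ (B : ℝ), 0 < B → ∀ (ε : ℝ≥0), 0 < ε →
        Metric.coveringNumber ε (boundedConcaveSeq n B) ≠ ⊤ ∧
        Real.log ((Metric.coveringNumber ε (boundedConcaveSeq n B)).toNat : ℝ) ≤
          C * (n : ℝ) ^ (1 / 4 : ℝ) * Real.sqrt (B / (ε : ℝ)) := by
  -- The factor `12` is chosen so that `8 * 44 ^ 2 = 15488` is at most `12 ^ 4 = 20736`.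
  refine ⟨1320 * 12, by norm_num, fun n hn B hB ε hε => ?_⟩
  have hε' : (0 : ℝ) < ε := hε
  have hn' : (0 : ℝ) < n := by exact_mod_cast (by omega : 0 < n)
  have hn4 : ((n : ℝ) ^ (1 / 4 : ℝ)) ^ 4 = n := by
    rw [← Real.rpow_natCast, ← Real.rpow_mul hn'.le]; norm_num
  have hs : √(B / (ε : ℝ)) ^ 2 = B / ε := Real.sq_sqrt (by positivity)
  have hpos : 0 < (n : ℝ) ^ (1 / 4 : ℝ) := by positivity
  have hpos' : 0 < √(B / (ε : ℝ)) := Real.sqrt_pos.2 (by positivity)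
  have h := coded_boundedConcaveSeq (n := n) (B := B) (ε := ε)
    (X := 12 * (n : ℝ) ^ (1 / 4 : ℝ) * √(B / (ε : ℝ))) (by omega) hB (by positivity) hε' ?_
  · obtain ⟨h1, h2⟩ := h.coveringNumber_le
    exact ⟨h1, h2.trans (le_of_eq (by ring))⟩
  · rw [mul_pow _ √(B / (ε : ℝ)), hs]
    generalize (n : ℝ) ^ (1 / 4 : ℝ) = y at *
    rw [← hn4]
    have : 8 * y ^ 4 * (44 * (B / ((12 * y) ^ 2 * (B / ε)))) ^ 2 = 15488 / 20736 * (ε : ℝ) ^ 2 := by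
      field_simp
      norm_num
    rw [this]
    nlinarith [sq_nonneg (ε : ℝ)]
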